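/- **Semantic characterization of the existential graphs Gamma-LD.** *Formulas.* Fix a countably infinite set of classical atoms $a$ and, for each of them, an alternate atom $\underline a$. The set FOR of LD formulas is generated from all these atoms by the classical connectives $\sim,\supset,\cup,\bullet,\equiv$, the alternate negation $\neg$ and the alternate connectives $\to,\vee,\wedge,\leftrightarrow$. One writes $+X=\neg{\sim}X$, and $X\to Y$, $X\vee Y$, $X\wedge Y$, $X\leftrightarrow Y$ are defined as $+(X\supset Y)$, $+(X\cup Y)$, $+(X\bullet Y)$, $+(X\equiv Y)$. *Semantics.* A model consists of a set $S$ of worlds, an actual world $M_A\in S$, a reflexive, transitive and antisymmetric relation $R$ on $S$, and a valuation $V:S\times \mathrm{FOR}\to\{0,1\}$ such that at every world $\sim,\supset,\cup,\bullet,\equiv$ have their classical truth tables; $V(M,\neg X)=1$ iff $V(N,X)=0$ for all $N$ with $MRN$; $V(M,\underline a)=1$ iff $V(N,\underline a)=1$ for all $N$ with $MRN$; and each of $X\to Y$, $X\vee Y$, $X\wedge Y$, $X\leftrightarrow Y$ has the value of the formula that defines it. A formula $X$ is *valid* ($X\in\mathrm{VAL}$) if $V(M_A,X)=1$ in every model.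 *Graphs.* Gamma-LD graphs are generated from the atoms (classical and alternate) and the empty graph $\lambda$ by the classical cut $(X)$, the paracomplete cut $⟦X⟧$ and juxtaposition $XY$. They are drawn on a sheet, so the order and grouping of juxtaposed graphs are immaterial and $\lambda$ is the blank. A graph is *alternate*, written $\underline X$, if it is an alternate atom or of the form $⟦Y⟧$. A region is even or odd according to the number of cuts of either kind that surround it. The transformation rules, applicable to subgraphs at any place (subject to the stated parity), are: 1. erasure, in even regions: $XY\Rightarrow X$ and $XY\Rightarrow Y$; 2. insertion, in odd regions: $X\Rightarrow XY$ and $X\Rightarrow YX$; 3. classical double cut: $X\Leftrightarrow((X))$; 4. change of cut: $⟦X⟧\Rightarrow(X)$ in even regions, $(X)\Rightarrow⟦X⟧$ in odd regions; 5. mixed double cut for valid graphs: $X\Leftrightarrow⟦(X)⟧$ whenever $X$ is a valid graph; 6. strong mixed double cut: $\underline X\Rightarrow⟦(\underline X)⟧$ in even regions, $⟦(\underline X)⟧\Rightarrow\underline X$ in odd regions; 7. iteration and deiteration: $X\Leftrightarrow XX$; 8. classical iteration and deiteration: $X\,D[Y]\Leftrightarrow X\,D[XY]$, where the hole of $D[\cdot]$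 is surrounded within $D$ by classical cuts only; 9. strong iteration and deiteration: $\underline X\,D[Y]\Leftrightarrow \underline X\,D[\underline XY]$, where cuts of both kinds may surround the hole of $D[\cdot]$. A graph is *valid* ($\in\mathrm{GEV}$) if it is obtained from $\lambda$ by finitely many applications of the rules; because of rule 5, validity and derivability are defined by simultaneous induction. *Translation.* $X\mapsto X'$ from FOR to Gamma-LD is given by $a'=a$ and $\underline a'=\underline a$ for atoms, $(\sim X)'=(X')$, $(X\bullet Y)'=X'Y'$, $(X\supset Y)'=(X'(Y'))$, $(X\equiv Y)'=(X'(Y'))(Y'(X'))$, $(X\cup Y)'=((X')(Y'))$, $(\neg X)'=⟦X'⟧$ (hence $(+X)'=⟦(X')⟧$), $(X\to Y)'=⟦X'(Y')⟧$, $(X\vee Y)'=⟦(X')(Y')⟧$, $(X\wedge Y)'=⟦(X'Y')⟧$, $(X\leftrightarrow Y)'=⟦X'(Y')⟧⟦Y'(X')⟧$. **Theorem.** For every $X\in\mathrm{FOR}$: $X\in\mathrm{VAL}$ if and only if $X'\in\mathrm{GEV}$. -/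

import Mathlib

universe u

namespace LD

/-! ### Formulas -/

/-- The formulas of LD. There is one classical atom `a` and one alternate atom `a̲` for each natural
number. The connectives are `∼ ¬ ⊃ ∪ • ≡` and the alternate binary ones `→ ∨ ∧ ↔`. -/
inductive Form : Type
  | atom (a : ℕ) : Form
  | altAtom (a : ℕ) : Form
  | neg (X : Form) : Form
  | altNeg (X : Form) : Form
  | imp (X Y : Form) : Form
  | or (X Y : Form) : Form
  | and (X Y : Form) : Form
  | iff (X Y : Form) : Form
  | altImp (X Y : Form) : Form
  | altOr (X Y : Form) : Form
  | altAnd (X Y : Form) : Form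
  | altIff (X Y : Form) : Form

/-- Alternate affirmation: `+X = ¬∼X`. -/
def Form.plus (X : Form) : Form := .altNeg (.neg X)

/-! ### Possible-worlds semantics -/

/-- A model of LD: worlds, an actual world, a reflexive, transitive and antisymmetric accessibility
relation, and a valuation of all formulas in all worlds that obeys the valuation rules. -/
structure Model where
  World : Type u
  actual : World
  R : World → World → Prop
  refl : ∀ M, R M M
  trans : ∀ M N F, R M N → R N F → R M F
  antisymm : ∀ M N, R M N → R N M → M = N
  V : World → Form → Bool
  V_neg : ∀ M X, V M (.neg X) = true ↔ V M X = false
  V_and : ∀ M X Y, V M (.and X Y) = true ↔ V M X = true ∧ V M Y = true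
  V_or : ∀ M X Y, V M (.or X Y) = true ↔ V M X = true ∨ V M Y = true
  V_imp : ∀ M X Y, V M (.imp X Y) = true ↔ (V M X = true → V M Y = true)
  V_iff : ∀ M X Y, V M (.iff X Y) = true ↔ V M X = V M Y
  V_altNeg : ∀ M X, V M (.altNeg X) = true ↔ ∀ N, R M N → V N X = false
  V_altAtom : ∀ M a, V M (.altAtom a) = true ↔ ∀ N, R M N → V N (.altAtom a) = true
  /- The alternate binary connectives are defined through `+`. -/
  V_altImp : ∀ M X Y, V M (.altImp X Y) = V M (Form.plus (.imp X Y))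
  V_altOr : ∀ M X Y, V M (.altOr X Y) = V M (Form.plus (.or X Y))
  V_altAnd : ∀ M X Y, V M (.altAnd X Y) = V M (Form.plus (.and X Y))
  V_altIff : ∀ M X Y, V M (.altIff X Y) = V M (Form.plus (.iff X Y))

/-- A formula is valid when it is true in the actual world of every model. -/
def Form.Valid (X : Form) : Prop := ∀ m : Model.{u}, m.V m.actual X = true

/-! ### Existential graphs -/

/-- Descriptions of the Gamma-LD graphs: atoms, the empty graph `λ`, the classical cut `(X)`, the
paracomplete cut `⟦X⟧` and the juxtaposition `XY`. -/
inductive Graph : Type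
  | atom (a : ℕ) : Graph
  | altAtom (a : ℕ) : Graph
  | lam : Graph
  | cut (X : Graph) : Graph
  | altCut (X : Graph) : Graph
  | juxt (X Y : Graph) : Graph

namespace Graph

/-- Two descriptions of the same drawing on the sheet: in each region the order and the grouping of
the juxtaposed graphs are immaterial, and `λ` is the blank. -/
inductive Same : Graph → Graph → Prop
  | refl (X : Graph) : Same X X
  | symm {X Y : Graph} : Same X Y → Same Y X
  | trans {X Y Z : Graph} : Same X Y → Same Y Z → Same X Z
  | cut {X Y : Graph} : Same X Y → Same (.cut X) (.cut Y)
  | altCut {X Y : Graph} : Same X Y → Same (.altCut X) (.altCut Y)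
  | juxt {X X' Y Y' : Graph} : Same X X' → Same Y Y' → Same (.juxt X Y) (.juxt X' Y')
  | comm (X Y : Graph) : Same (.juxt X Y) (.juxt Y X)
  | assoc (X Y Z : Graph) : Same (.juxt (.juxt X Y) Z) (.juxt X (.juxt Y Z))
  | blank (X : Graph) : Same (.juxt .lam X) X

/-- The alternate graphs: `⟦Y⟧` and the alternate atoms. -/
inductive IsAlt : Graph → Prop
  | altAtom (a : ℕ) : IsAlt (.altAtom a)
  | altCut (Y : Graph) : IsAlt (.altCut Y)

/-- A place in a graph: a graph with one hole. -/
inductive Place : Type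
  | hole : Place
  | left (C : Place) (G : Graph) : Place
  | right (G : Graph) (C : Place) : Place
  | cut (C : Place) : Place
  | altCut (C : Place) : Place

/-- The graph `C[X]` obtained by drawing `X` in the hole. -/
def Place.fill : Place → Graph → Graph
  | .hole, X => X
  | .left C G, X => .juxt (C.fill X) G
  | .right G C, X => .juxt G (C.fill X)
  | .cut C, X => .cut (C.fill X)
  | .altCut C, X => .altCut (C.fill X)

/-- The number of cuts, of either kind, that surround the hole. -/
def Place.depth : Place → ℕ
  | .hole => 0
  | .left C _ => C.depth
  | .right _ C => C.depth
  | .cut C => C.depth + 1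
  | .altCut C => C.depth + 1

/-- No paracomplete cut surrounds the hole. -/
def Place.Classical : Place → Prop
  | .hole => True
  | .left C _ => C.Classical
  | .right _ C => C.Classical
  | .cut C => C.Classical
  | .altCut _ => False

/-- One application of a primitive transformation rule other than the mixed double cut for valid
graphs. The place `C` is where the rule is applied. -/
inductive Step : Graph → Graph → Prop
  | redraw {X Y : Graph} : Same X Y → Step X Y
  /- Erasure in an even region. -/
  | erase_right (C : Place) (X Y : Graph) : Even C.depth →
      Step (C.fill (.juxt X Y)) (C.fill X)
  | erase_left (C : Place) (X Y : Graph) : Even C.depth →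
      Step (C.fill (.juxt X Y)) (C.fill Y)
  /- Insertion in an odd region. -/
  | insert_right (C : Place) (X Y : Graph) : Odd C.depth →
      Step (C.fill X) (C.fill (.juxt X Y))
  | insert_left (C : Place) (X Y : Graph) : Odd C.depth →
      Step (C.fill X) (C.fill (.juxt Y X))
  /- Classical double cut. -/
  | doubleCut (C : Place) (X : Graph) :
      Step (C.fill X) (C.fill (.cut (.cut X)))
  | doubleCut_inv (C : Place) (X : Graph) :
      Step (C.fill (.cut (.cut X))) (C.fill X)
  /- Change of cut. -/
  | change_even (C : Place) (X : Graph) : Even C.depth →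
      Step (C.fill (.altCut X)) (C.fill (.cut X))
  | change_odd (C : Place) (X : Graph) : Odd C.depth →
      Step (C.fill (.cut X)) (C.fill (.altCut X))
  /- Strong mixed double cut. -/
  | strongMixed_even (C : Place) (X : Graph) : X.IsAlt → Even C.depth →
      Step (C.fill X) (C.fill (.altCut (.cut X)))
  | strongMixed_odd (C : Place) (X : Graph) : X.IsAlt → Odd C.depth →
      Step (C.fill (.altCut (.cut X))) (C.fill X)
  /- Iteration and deiteration in the same region. -/
  | iterate (C : Place) (X : Graph) :
      Step (C.fill X) (C.fill (.juxt X X))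
  | deiterate (C : Place) (X : Graph) :
      Step (C.fill (.juxt X X)) (C.fill X)
  /- Classical iteration and deiteration, across classical cuts only. -/
  | iterate_classical (C D : Place) (X Y : Graph) : D.Classical →
      Step (C.fill (.juxt X (D.fill Y))) (C.fill (.juxt X (D.fill (.juxt X Y))))
  | deiterate_classical (C D : Place) (X Y : Graph) : D.Classical →
      Step (C.fill (.juxt X (D.fill (.juxt X Y)))) (C.fill (.juxt X (D.fill Y)))
  /- Strong iteration and deiteration of alternate graphs, across cuts of both kinds. -/
  | iterate_strong (C D : Place) (X Y : Graph) : X.IsAlt →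
      Step (C.fill (.juxt X (D.fill Y))) (C.fill (.juxt X (D.fill (.juxt X Y))))
  | deiterate_strong (C D : Place) (X Y : Graph) : X.IsAlt →
      Step (C.fill (.juxt X (D.fill (.juxt X Y)))) (C.fill (.juxt X (D.fill Y)))

/-- `X ≫ Z`: a finite number of applications of the transformation rules leads from `X` to `Z`.
The last two constructors are the mixed double cut for valid graphs: a graph `Y` with `λ ≫ Y` may be
exchanged with `⟦(Y)⟧` in every region. -/
inductive Derives : Graph → Graph → Prop
  | refl (X : Graph) : Derives X X
  | step {X Y Z : Graph} : Derives X Y → Step Y Z → Derives X Z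
  | mixed {X : Graph} (C : Place) (Y : Graph) : Derives .lam Y →
      Derives X (C.fill Y) → Derives X (C.fill (.altCut (.cut Y)))
  | mixed_inv {X : Graph} (C : Place) (Y : Graph) : Derives .lam Y →
      Derives X (C.fill (.altCut (.cut Y))) → Derives X (C.fill Y)

/-- A graph is valid when it is obtained from the empty sheet by the transformation rules. -/
def Valid (X : Graph) : Prop := Derives .lam X

end Graph

/-! ### Translation -/

/-- The translation `X ↦ X'` of formulas into graphs. (For `+X = ¬∼X` it gives `⟦(X')⟧`.) -/
def Form.toGraph : Form → Graph
  | .atom a => .atom a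
  | .altAtom a => .altAtom a
  | .neg X => .cut X.toGraph
  | .and X Y => .juxt X.toGraph Y.toGraph
  | .imp X Y => .cut (.juxt X.toGraph (.cut Y.toGraph))
  | .iff X Y => .juxt (.cut (.juxt X.toGraph (.cut Y.toGraph)))
      (.cut (.juxt Y.toGraph (.cut X.toGraph)))
  | .or X Y => .cut (.juxt (.cut X.toGraph) (.cut Y.toGraph))
  | .altNeg X => .altCut X.toGraph
  | .altImp X Y => .altCut (.juxt X.toGraph (.cut Y.toGraph))
  | .altOr X Y => .altCut (.juxt (.cut X.toGraph) (.cut Y.toGraph))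
  | .altAnd X Y => .altCut (.cut (.juxt X.toGraph Y.toGraph))
  | .altIff X Y => .juxt (.altCut (.juxt X.toGraph (.cut Y.toGraph)))
      (.altCut (.juxt Y.toGraph (.cut X.toGraph)))

end LD

/-! Read `⟦X⟧` as "X is false in all accessible worlds"; the logic is then S4, and graphs can be
evaluated directly at worlds. Soundness: every rule preserves truth at every world. One-way rules
follow parity, since each cut reverses implication. Strong iteration works because alternate graphs
persist along accessibility. A graph derived from `λ` holds in all worlds of the model, which
justifies the mixed double cut. Completeness is a canonical model argument. Derivations run inside
even regions (`Derives.fill`), which gives the deduction theorem (`Derives.valid`). The mixed double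
cut acts as necessitation, and strong deiteration discharges alternate premises; together they give
`Entails.altCut`, hence the modal clause `MaxCons.altCut_mem` for maximal consistent sets. Tagging
these sets with natural numbers makes accessibility antisymmetric without changing that clause. -/

namespace LD

namespace Graph

/-! ### Places and derivations -/

/-- The place `C[D[·]]`. -/
def Place.comp : Place → Place → Place
  | .hole, D => D
  | .left C G, D => .left (C.comp D) G
  | .right G C, D => .right G (C.comp D)
  | .cut C, D => .cut (C.comp D)
  | .altCut C, D => .altCut (C.comp D)

theorem Place.fill_comp (C D : Place) (X : Graph) : (C.comp D).fill X = C.fill (D.fill X) := by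
  induction C <;> simp [Place.comp, Place.fill, *]

theorem Place.depth_comp (C D : Place) : (C.comp D).depth = C.depth + D.depth := by
  induction C <;> simp [Place.comp, Place.depth, *] <;> omega

theorem Same.fill (C : Place) {X Y : Graph} (h : Same X Y) : Same (C.fill X) (C.fill Y) := by
  induction C with
  | hole => exact h
  | left C G ih => exact .juxt ih (.refl G)
  | right G C ih => exact .juxt (.refl G) ih
  | cut C ih => exact .cut ih
  | altCut C ih => exact .altCut ih

/-- Depths add under composition, so an even outer place keeps the parity of every inner region and
each side condition survives. -/
theorem Step.fill {C : Place} (hC : Even C.depth) {X Y : Graph} (h : Step X Y) :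
    Step (C.fill X) (C.fill Y) := by
  have even {D : Place} (hD : Even D.depth) : Even (C.comp D).depth := by
    rw [Place.depth_comp]; exact hC.add hD
  have odd {D : Place} (hD : Odd D.depth) : Odd (C.comp D).depth := by
    rw [Place.depth_comp]; exact hC.add_odd hD
  cases h with
  | redraw h => exact .redraw (h.fill C)
  | erase_right D X Y h => simpa only [Place.fill_comp] using Step.erase_right _ X Y (even h)
  | erase_left D X Y h => simpa only [Place.fill_comp] using Step.erase_left _ X Y (even h)
  | insert_right D X Y h => simpa only [Place.fill_comp] using Step.insert_right _ X Y (odd h)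
  | insert_left D X Y h => simpa only [Place.fill_comp] using Step.insert_left _ X Y (odd h)
  | doubleCut D X => simpa only [Place.fill_comp] using Step.doubleCut (C.comp D) X
  | doubleCut_inv D X => simpa only [Place.fill_comp] using Step.doubleCut_inv (C.comp D) X
  | change_even D X h => simpa only [Place.fill_comp] using Step.change_even _ X (even h)
  | change_odd D X h => simpa only [Place.fill_comp] using Step.change_odd _ X (odd h)
  | strongMixed_even D X hX h =>
    simpa only [Place.fill_comp] using Step.strongMixed_even _ X hX (even h)
  | strongMixed_odd D X hX h =>
    simpa only [Place.fill_comp] using Step.strongMixed_odd _ X hX (odd h)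
  | iterate D X => simpa only [Place.fill_comp] using Step.iterate (C.comp D) X
  | deiterate D X => simpa only [Place.fill_comp] using Step.deiterate (C.comp D) X
  | iterate_classical D E X Y h =>
    simpa only [Place.fill_comp] using Step.iterate_classical (C.comp D) E X Y h
  | deiterate_classical D E X Y h =>
    simpa only [Place.fill_comp] using Step.deiterate_classical (C.comp D) E X Y h
  | iterate_strong D E X Y h =>
    simpa only [Place.fill_comp] using Step.iterate_strong (C.comp D) E X Y h
  | deiterate_strong D E X Y h =>
    simpa only [Place.fill_comp] using Step.deiterate_strong (C.comp D) E X Y h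

theorem Step.derives {X Y : Graph} (h : Step X Y) : Derives X Y := .step (.refl X) h

theorem Same.derives {X Y : Graph} (h : Same X Y) : Derives X Y := (Step.redraw h).derives

theorem Derives.trans {X Y Z : Graph} (h₁ : Derives X Y) (h₂ : Derives Y Z) : Derives X Z := by
  induction h₂ with
  | refl => exact h₁
  | step _ hs ih => exact .step (ih h₁) hs
  | mixed C Y hY _ _ ih => exact .mixed C Y hY (ih h₁)
  | mixed_inv C Y hY _ _ ih => exact .mixed_inv C Y hY (ih h₁)

/-- Derivations can be carried out in every even region. -/
theorem Derives.fill {C : Place} (hC : Even C.depth) {X Y : Graph} (h : Derives X Y) :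
    Derives (C.fill X) (C.fill Y) := by
  induction h with
  | refl => exact .refl _
  | step _ hs ih => exact .step ih (hs.fill hC)
  | mixed D Y hY _ _ ih =>
    have := Derives.mixed (C.comp D) Y hY (by rw [Place.fill_comp]; exact ih)
    rwa [Place.fill_comp] at this
  | mixed_inv D Y hY _ _ ih =>
    have := Derives.mixed_inv (C.comp D) Y hY (by rw [Place.fill_comp]; exact ih)
    rwa [Place.fill_comp] at this

theorem derives_left (X Y : Graph) : Derives (.juxt X Y) X :=
  (Step.erase_right .hole X Y ⟨0, rfl⟩).derives

theorem derives_right (X Y : Graph) : Derives (.juxt X Y) Y :=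
  (Step.erase_left .hole X Y ⟨0, rfl⟩).derives

/-- Iterate `Z`, then transform the two copies separately. -/
theorem Derives.juxt {Z X Y : Graph} (hX : Derives Z X) (hY : Derives Z Y) :
    Derives Z (.juxt X Y) :=
  ((Step.iterate .hole Z).derives.trans (hX.fill (C := .left .hole Z) ⟨0, rfl⟩)).trans
    (hY.fill (C := .right X .hole) ⟨0, rfl⟩)

theorem derives_lam (X : Graph) : Derives X .lam :=
  (Same.blank X).symm.derives.trans (derives_left .lam X)

theorem Valid.derives {Y : Graph} (h : Valid Y) (X : Graph) : Derives X Y :=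
  (derives_lam X).trans h

/-- The deduction theorem. -/
theorem Derives.valid {X Y : Graph} (h : Derives X Y) : Valid (.cut (.juxt X (.cut Y))) := by
  -- Start from `((λ))`, insert `X` between the cuts and iterate it into the inner one: `(X(X))`.
  -- The inner copy lies at depth two, an even region, so the given derivation runs there.
  have h₁ : Derives .lam (.cut (.cut .lam)) := (Step.doubleCut .hole .lam).derives
  have h₂ := h₁.step (Step.insert_left (.cut .hole) (.cut .lam) X ⟨0, rfl⟩)
  have h₃ := h₂.step (Step.iterate_classical (.cut .hole) (.cut .hole) X .lam trivial)
  have h₄ := h₃.trans ((derives_left X .lam).fill (C := .cut (.right X (.cut .hole))) ⟨1, rfl⟩)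
  exact h₄.trans (h.fill (C := .cut (.right X (.cut .hole))) ⟨1, rfl⟩)

/-- The contradictory graph, an empty classical cut. -/
abbrev bot : Graph := .cut .lam

theorem derives_cut_of_imp_bot (X : Graph) :
    Derives (.cut (.juxt X (.cut bot))) (.cut X) :=
  (Step.doubleCut_inv (.cut (.right X .hole)) .lam).derives.step
    (.redraw (.cut ((Same.comm X .lam).trans (.blank X))))

theorem derives_bot_of_cut (X : Graph) : Derives (.juxt X (.cut X)) bot :=
  ((Same.juxt (.refl X) (.cut ((Same.blank X).symm.trans (.comm _ _)))).derives.step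
    (.deiterate_classical .hole (.cut .hole) X .lam trivial)).trans (derives_right _ _)

/-! ### Consequences of a set of graphs -/

/-- The juxtaposition of the graphs in a list. -/
def conj : List Graph → Graph
  | [] => .lam
  | X :: l => .juxt X (conj l)

theorem derives_conj_mem {l : List Graph} {X : Graph} (h : X ∈ l) : Derives (conj l) X := by
  induction l with
  | nil => simp at h
  | cons Y l ih =>
    rcases List.mem_cons.1 h with rfl | h
    · exact derives_left _ _
    · exact (derives_right _ _).trans (ih h)

theorem derives_conj {Z : Graph} {l : List Graph} (h : ∀ X ∈ l, Derives Z X) :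
    Derives Z (conj l) := by
  induction l with
  | nil => exact derives_lam Z
  | cons Y l ih =>
    exact (h Y (by simp)).juxt (ih fun X hX => h X (by simp [hX]))

/-- `Y` is derivable from finitely many of the graphs in `Γ`. -/
def Entails (Γ : Set Graph) (Y : Graph) : Prop :=
  ∃ l : List Graph, (∀ X ∈ l, X ∈ Γ) ∧ Derives (conj l) Y

theorem Entails.of_mem {Γ : Set Graph} {X : Graph} (h : X ∈ Γ) : Entails Γ X :=
  ⟨[X], by simpa using h, derives_conj_mem (by simp)⟩

theorem Entails.trans {Γ : Set Graph} {X Y : Graph} (h : Entails Γ X) (hXY : Derives X Y) :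
    Entails Γ Y :=
  let ⟨l, hl, hX⟩ := h
  ⟨l, hl, hX.trans hXY⟩

theorem Entails.juxt {Γ : Set Graph} {X Y : Graph} (hX : Entails Γ X) (hY : Entails Γ Y) :
    Entails Γ (.juxt X Y) := by
  obtain ⟨l₁, h₁, hX⟩ := hX
  obtain ⟨l₂, h₂, hY⟩ := hY
  refine ⟨l₁ ++ l₂, fun Z hZ => (List.mem_append.1 hZ).elim (h₁ Z) (h₂ Z), Derives.juxt ?_ ?_⟩
  · exact (derives_conj fun Z hZ => derives_conj_mem (by simp [hZ])).trans hX
  · exact (derives_conj fun Z hZ => derives_conj_mem (by simp [hZ])).trans hY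

theorem Entails.exists_derives {Γ : Set Graph} {X Y : Graph} (h : Entails (insert X Γ) Y) :
    ∃ l : List Graph, (∀ Z ∈ l, Z ∈ Γ) ∧ Derives (.juxt (conj l) X) Y := by
  classical
  obtain ⟨l, hl, hY⟩ := h
  refine ⟨l.filter (· ≠ X), fun Z hZ => ?_, (derives_conj fun Z hZ => ?_).trans hY⟩
  · simp only [List.mem_filter, decide_eq_true_eq] at hZ
    exact (hl Z hZ.1).resolve_left hZ.2
  · by_cases hZX : Z = X
    · exact hZX ▸ derives_right _ _
    · exact (derives_left _ _).trans (derives_conj_mem (by simp [hZ, hZX]))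

/-- The deduction theorem puts premises and `X` together in one valid cut; beside another copy of
the premises, those inside can be deiterated. -/
theorem Entails.imp {Γ : Set Graph} {X Y : Graph} (h : Entails (insert X Γ) Y) :
    Entails Γ (.cut (.juxt X (.cut Y))) := by
  obtain ⟨l, hl, hY⟩ := h.exists_derives
  refine ⟨l, hl, ?_⟩
  refine ((hY.valid.derives (conj l)).juxt (.refl (conj l))).trans ?_
  refine (Same.trans (.comm _ _) (.juxt (.refl _) (.cut (.assoc _ _ _)))).derives.trans ?_
  exact (Step.deiterate_classical .hole (.cut .hole) (conj l) _ trivial).derives.trans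
    (derives_right _ _)

theorem Entails.cut {Γ : Set Graph} {X : Graph} (h : Entails (insert X Γ) bot) :
    Entails Γ (.cut X) :=
  h.imp.trans (derives_cut_of_imp_bot X)

/-- Alternate graphs that are at hand can be removed from a paracomplete cut. -/
theorem Derives.altCut_deiterate {Z X : Graph} {l : List Graph}
    (hl : ∀ A ∈ l, A.IsAlt ∧ Derives Z A) (h : Derives Z (.altCut (.juxt (conj l) X))) :
    Derives Z (.altCut X) := by
  induction l with
  | nil => exact h.step (.redraw (.altCut (.blank X)))
  | cons A l ih =>
    refine ih (fun B hB => hl B (by simp [hB])) ?_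
    obtain ⟨hA, hZ⟩ := hl A (by simp)
    exact ((hZ.juxt (h.step (.redraw (.altCut (.assoc _ _ _))))).step
      (.deiterate_strong .hole (.altCut .hole) A _ hA)).trans (derives_right _ _)

/-- The premises `L` with `X` give a valid graph `(LX)`, which the mixed double cut turns into
`⟦((LX))⟧`, hence `⟦LX⟧`. The premises are alternate, so they deiterate across the paracomplete cut.
-/
theorem Entails.altCut {Γ : Set Graph} {X : Graph} (hΓ : ∀ A ∈ Γ, A.IsAlt)
    (h : Entails (insert X Γ) bot) : Entails Γ (.altCut X) := by
  obtain ⟨l, hl, hX⟩ := h.exists_derives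
  have h₁ : Valid (.cut (.juxt (conj l) X)) := hX.valid.trans (derives_cut_of_imp_bot _)
  have h₂ : Valid (.altCut (.juxt (conj l) X)) :=
    (Derives.mixed .hole _ h₁ h₁).step (.doubleCut_inv (.altCut .hole) _)
  exact ⟨l, hl, (h₂.derives (conj l)).altCut_deiterate fun A hA =>
    ⟨hΓ A (hl A hA), derives_conj_mem hA⟩⟩

/-! ### Maximal consistent sets -/

/-- The maximal sets of graphs from which the contradictory graph is not derivable. -/
def MaxCons (Γ : Set Graph) : Prop := Maximal (fun Δ => ¬ Entails Δ bot) Γ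

/-- Derivations use finitely many premises, so consistency has finite character and the
Teichmüller–Tukey lemma applies. -/
theorem exists_maxCons {Γ : Set Graph} (h : ¬ Entails Γ bot) : ∃ Δ, Γ ⊆ Δ ∧ MaxCons Δ := by
  have hF : Order.IsOfFiniteCharacter {Δ : Set Graph | ¬ Entails Δ bot} := by
    intro Δ
    constructor
    · rintro hΔ Θ hΘ - ⟨l, hl, hb⟩
      exact hΔ ⟨l, fun X hX => hΘ (hl X hX), hb⟩
    · rintro hΔ ⟨l, hl, hb⟩
      exact hΔ {X | X ∈ l} hl l.finite_toSet ⟨l, fun X hX => hX, hb⟩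
  obtain ⟨Δ, hΓ, hΔ⟩ := hF.exists_maximal h
  exact ⟨Δ, hΓ, hΔ⟩

namespace MaxCons

variable {Γ : Set Graph} (hΓ : MaxCons Γ)
include hΓ

theorem entails_cut {X : Graph} (h : X ∉ Γ) : Entails Γ (.cut X) := by
  by_contra hX
  exact h (hΓ.2 (fun hb => hX hb.cut) (Set.subset_insert X Γ) (Set.mem_insert X Γ))

theorem mem_of_entails {X : Graph} (h : Entails Γ X) : X ∈ Γ := by
  by_contra hX
  exact hΓ.1 ((h.juxt (hΓ.entails_cut hX)).trans (derives_bot_of_cut X))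

theorem cut_mem {X : Graph} : .cut X ∈ Γ ↔ X ∉ Γ :=
  ⟨fun h hX => hΓ.1 (((Entails.of_mem hX).juxt (.of_mem h)).trans (derives_bot_of_cut X)),
    fun h => hΓ.mem_of_entails (hΓ.entails_cut h)⟩

theorem juxt_mem {X Y : Graph} : .juxt X Y ∈ Γ ↔ X ∈ Γ ∧ Y ∈ Γ :=
  ⟨fun h => ⟨hΓ.mem_of_entails ((Entails.of_mem h).trans (derives_left _ _)),
    hΓ.mem_of_entails ((Entails.of_mem h).trans (derives_right _ _))⟩,
    fun h => hΓ.mem_of_entails ((Entails.of_mem h.1).juxt (.of_mem h.2))⟩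

/-- Left to right, `⟦X⟧` is itself alternate, so it passes to `Δ` and weakens there to `(X)`.
Conversely, if `⟦X⟧` is missing, `Entails.altCut` makes `X` consistent with the alternate members of
`Γ`; extend to a maximal set. -/
theorem altCut_mem {X : Graph} :
    .altCut X ∈ Γ ↔ ∀ Δ, MaxCons Δ → (∀ A ∈ Γ, A.IsAlt → A ∈ Δ) → X ∉ Δ := by
  constructor
  · intro h Δ hΔ hR
    exact hΔ.cut_mem.1 (hΔ.mem_of_entails ((Entails.of_mem (hR _ h (.altCut X))).trans
      (Step.change_even .hole X ⟨0, rfl⟩).derives))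
  · intro h
    by_contra hX
    have hcons : ¬ Entails (insert X {A ∈ Γ | A.IsAlt}) bot := fun hb => by
      obtain ⟨l, hl, hd⟩ := hb.altCut fun A hA => hA.2
      exact hX (hΓ.mem_of_entails ⟨l, fun A hA => (hl A hA).1, hd⟩)
    obtain ⟨Δ, hsub, hΔ⟩ := exists_maxCons hcons
    exact h Δ hΔ (fun A hA hAlt => hsub (Or.inr ⟨hA, hAlt⟩)) (hsub (Or.inl rfl))

end MaxCons

/-! ### Soundness -/

/-- Truth of a graph at a world of a model. -/
def Holds (m : Model.{u}) : m.World → Graph → Prop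
  | M, .atom a => m.V M (.atom a) = true
  | M, .altAtom a => m.V M (.altAtom a) = true
  | _, .lam => True
  | M, .cut X => ¬ Holds m M X
  | M, .altCut X => ∀ N, m.R M N → ¬ Holds m N X
  | M, .juxt X Y => Holds m M X ∧ Holds m M Y

section

variable {m : Model.{u}}

theorem Same.holds_iff {X Y : Graph} (h : Same X Y) (M : m.World) :
    Holds m M X ↔ Holds m M Y := by
  induction h generalizing M with
  | refl => rfl
  | symm _ ih => exact (ih M).symm
  | trans _ _ ih₁ ih₂ => exact (ih₁ M).trans (ih₂ M)
  | cut _ ih => simp only [Holds, ih]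
  | altCut _ ih => simp only [Holds, ih]
  | juxt _ _ ih₁ ih₂ => simp only [Holds, ih₁, ih₂]
  | comm => simp only [Holds, and_comm]
  | assoc => simp only [Holds, and_assoc]
  | blank => simp only [Holds, true_and]

theorem IsAlt.holds_of_rel {X : Graph} (h : X.IsAlt) {M N : m.World} (hR : m.R M N)
    (hX : Holds m M X) : Holds m N X := by
  cases h with
  | altAtom a => exact (m.V_altAtom M a).1 hX N hR
  | altCut Y => exact fun F hF => hX F (m.trans _ _ _ hR hF)

/-- Each cut exchanges the two parities, so monotonicity and antitonicity need a joint induction. -/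
theorem Place.holds_fill (C : Place) {X Y : Graph} :
    (Even C.depth → (∀ M, Holds m M X → Holds m M Y) →
      ∀ M, Holds m M (C.fill X) → Holds m M (C.fill Y)) ∧
    (Odd C.depth → (∀ M, Holds m M Y → Holds m M X) →
      ∀ M, Holds m M (C.fill X) → Holds m M (C.fill Y)) := by
  induction C generalizing X Y with
  | hole => exact ⟨fun _ h => h, fun h => absurd h (by decide)⟩
  | left C G ih =>
    exact ⟨fun hC h M hX => ⟨ih.1 hC h M hX.1, hX.2⟩, fun hC h M hX => ⟨ih.2 hC h M hX.1, hX.2⟩⟩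
  | right G C ih =>
    exact ⟨fun hC h M hX => ⟨hX.1, ih.1 hC h M hX.2⟩, fun hC h M hX => ⟨hX.1, ih.2 hC h M hX.2⟩⟩
  | cut C ih =>
    simp only [Place.depth, Nat.even_add_one, Nat.odd_add_one, Nat.not_even_iff_odd,
      Nat.not_odd_iff_even]
    exact ⟨fun hC h M hX hY => hX (ih.2 hC h M hY), fun hC h M hX hY => hX (ih.1 hC h M hY)⟩
  | altCut C ih =>
    simp only [Place.depth, Nat.even_add_one, Nat.odd_add_one, Nat.not_even_iff_odd,
      Nat.not_odd_iff_even]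
    exact ⟨fun hC h M hX N hN hY => hX N hN (ih.2 hC h N hY),
      fun hC h M hX N hN hY => hX N hN (ih.1 hC h N hY)⟩

theorem Place.holds_fill_congr (C : Place) {X Y : Graph}
    (h : ∀ M, Holds m M X ↔ Holds m M Y) (M : m.World) :
    Holds m M (C.fill X) ↔ Holds m M (C.fill Y) := by
  induction C generalizing M with
  | hole => exact h M
  | left C G ih => simp only [Place.fill, Holds, ih]
  | right G C ih => simp only [Place.fill, Holds, ih]
  | cut C ih => simp only [Place.fill, Holds, ih]
  | altCut C ih => simp only [Place.fill, Holds, ih]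

theorem Place.Classical.holds_iterate {D : Place} (hD : D.Classical) {X : Graph} (Y : Graph)
    {M : m.World} (hX : Holds m M X) :
    Holds m M (D.fill Y) ↔ Holds m M (D.fill (.juxt X Y)) := by
  induction D with
  | hole => simp only [Place.fill, Holds, hX, true_and]
  | left C G ih => simp only [Place.fill, Holds, ih hD]
  | right G C ih => simp only [Place.fill, Holds, ih hD]
  | cut C ih => simp only [Place.fill, Holds, ih hD]
  | altCut C ih => exact hD.elim

theorem IsAlt.holds_iterate {X : Graph} (h : X.IsAlt) (D : Place) (Y : Graph) {M : m.World}
    (hX : Holds m M X) : Holds m M (D.fill Y) ↔ Holds m M (D.fill (.juxt X Y)) := by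
  induction D generalizing M with
  | hole => simp only [Place.fill, Holds, hX, true_and]
  | left C G ih => simp only [Place.fill, Holds, ih hX]
  | right G C ih => simp only [Place.fill, Holds, ih hX]
  | cut C ih => simp only [Place.fill, Holds, ih hX]
  | altCut C ih =>
    -- A paracomplete cut moves evaluation to an accessible world, where the alternate graph still
    -- holds.
    exact forall₂_congr fun N hN => not_congr (ih (h.holds_of_rel hN hX))

theorem IsAlt.holds_altCut_cut {X : Graph} (h : X.IsAlt) (M : m.World) :
    Holds m M (.altCut (.cut X)) ↔ Holds m M X :=
  ⟨fun hX => not_not.1 (hX M (m.refl M)), fun hX _ hN => not_not.2 (h.holds_of_rel hN hX)⟩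

theorem Step.holds {X Y : Graph} (h : Step X Y) (M : m.World) (hX : Holds m M X) :
    Holds m M Y := by
  cases h with
  | redraw h => exact (h.holds_iff M).1 hX
  | erase_right C X Y h => refine C.holds_fill.1 h ?_ M hX; exact fun _ h => h.1
  | erase_left C X Y h => refine C.holds_fill.1 h ?_ M hX; exact fun _ h => h.2
  | insert_right C X Y h => refine C.holds_fill.2 h ?_ M hX; exact fun _ h => h.1
  | insert_left C X Y h => refine C.holds_fill.2 h ?_ M hX; exact fun _ h => h.2
  | doubleCut C X => refine (C.holds_fill_congr ?_ M).2 hX; exact fun _ => not_not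
  | doubleCut_inv C X => refine (C.holds_fill_congr ?_ M).1 hX; exact fun _ => not_not
  | change_even C X h => refine C.holds_fill.1 h ?_ M hX; exact fun N h => h N (m.refl N)
  | change_odd C X h => refine C.holds_fill.2 h ?_ M hX; exact fun N h => h N (m.refl N)
  | strongMixed_even C X h _ => exact (C.holds_fill_congr h.holds_altCut_cut M).2 hX
  | strongMixed_odd C X h _ => exact (C.holds_fill_congr h.holds_altCut_cut M).1 hX
  | iterate C X => refine (C.holds_fill_congr ?_ M).2 hX; exact fun _ => and_self_iff
  | deiterate C X => refine (C.holds_fill_congr ?_ M).1 hX; exact fun _ => and_self_iff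
  | iterate_classical C D X Y h =>
    refine (C.holds_fill_congr ?_ M).1 hX
    exact fun _ => and_congr_right fun h' => h.holds_iterate Y h'
  | deiterate_classical C D X Y h =>
    refine (C.holds_fill_congr ?_ M).2 hX
    exact fun _ => and_congr_right fun h' => h.holds_iterate Y h'
  | iterate_strong C D X Y h =>
    refine (C.holds_fill_congr ?_ M).1 hX
    exact fun _ => and_congr_right fun h' => h.holds_iterate D Y h'
  | deiterate_strong C D X Y h =>
    refine (C.holds_fill_congr ?_ M).2 hX
    exact fun _ => and_congr_right fun h' => h.holds_iterate D Y h'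

theorem Derives.holds {X Y : Graph} (h : Derives X Y) (M : m.World) (hX : Holds m M X) :
    Holds m M Y := by
  -- A graph true in every world makes `⟦(Y)⟧` true in every world too, so exchanging them is
  -- harmless in any region.
  have key {Y : Graph} (hY : ∀ M, Holds m M .lam → Holds m M Y) (M : m.World) :
      Holds m M Y ↔ Holds m M (.altCut (.cut Y)) :=
    iff_of_true (hY M trivial) fun N _ => not_not.2 (hY N trivial)
  induction h generalizing M with
  | refl => exact hX
  | step _ hs ih => exact hs.holds M (ih M hX)
  | mixed C Y _ _ ihY ih => exact (C.holds_fill_congr (key ihY) M).1 (ih M hX)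
  | mixed_inv C Y _ _ ihY ih => exact (C.holds_fill_congr (key ihY) M).2 (ih M hX)

theorem V_iff_true (M : m.World) (X Y : Form) : m.V M (.iff X Y) = true ↔
    (m.V M X = true → m.V M Y = true) ∧ (m.V M Y = true → m.V M X = true) := by
  rw [m.V_iff, Bool.eq_iff_iff]
  exact iff_def

theorem holds_toGraph (X : Form) (M : m.World) :
    Holds m M X.toGraph ↔ m.V M X = true := by
  induction X generalizing M with
  | atom a => rfl
  | altAtom a => rfl
  | neg X ih => simp [Form.toGraph, Holds, m.V_neg, ih]
  | altNeg X ih => simp [Form.toGraph, Holds, m.V_altNeg, ih]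
  | imp X Y ihX ihY => simp [Form.toGraph, Holds, m.V_imp, ihX, ihY]
  | or X Y ihX ihY => simp [Form.toGraph, Holds, m.V_or, ihX, ihY]; grind
  | and X Y ihX ihY => simp [Form.toGraph, Holds, m.V_and, ihX, ihY]
  | iff X Y ihX ihY => simp [Form.toGraph, Holds, V_iff_true, ihX, ihY]
  | altImp X Y ihX ihY =>
    simp [Form.toGraph, Holds, m.V_altImp, Form.plus, m.V_altNeg, ← Bool.not_eq_true, m.V_neg,
      m.V_imp, ihX, ihY]
  | altOr X Y ihX ihY =>
    simp [Form.toGraph, Holds, m.V_altOr, Form.plus, m.V_altNeg, ← Bool.not_eq_true, m.V_neg,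
      m.V_or, ihX, ihY, or_iff_not_imp_left]
  | altAnd X Y ihX ihY =>
    simp [Form.toGraph, Holds, m.V_altAnd, Form.plus, m.V_altNeg, ← Bool.not_eq_true, m.V_neg,
      m.V_and, ihX, ihY]
  | altIff X Y ihX ihY =>
    simp only [Form.toGraph, Holds, m.V_altIff, Form.plus, m.V_altNeg, ← Bool.not_eq_true,
      m.V_neg, V_iff_true, ihX, ihY, not_not, not_and_not_right, forall_and]

end

/-! ### The canonical model -/

/-- Worlds are the maximal consistent sets, each repeated at every natural number: strict access
raises the number, which makes the accessibility relation antisymmetric. -/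
abbrev CanonicalWorld : Type u := ULift.{u} (ℕ × {Γ : Set Graph // MaxCons Γ})

/-- Every alternate graph in the first world is in the second one. -/
def Access (M N : CanonicalWorld.{u}) : Prop :=
  ∀ A ∈ M.down.2.1, A.IsAlt → A ∈ N.down.2.1

/-- The accessibility relation of the canonical model. -/
def CanonicalRel (M N : CanonicalWorld.{u}) : Prop :=
  M = N ∨ M.down.1 < N.down.1 ∧ Access M N

theorem CanonicalRel.access {M N : CanonicalWorld.{u}} (h : CanonicalRel M N) : Access M N := by
  rcases h with rfl | h
  · exact fun _ h _ => h
  · exact h.2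

theorem CanonicalRel.trans {M N F : CanonicalWorld.{u}} (h₁ : CanonicalRel M N)
    (h₂ : CanonicalRel N F) : CanonicalRel M F := by
  rcases h₁ with rfl | h₁
  · exact h₂
  · rcases h₂ with rfl | h₂
    · exact .inr h₁
    · exact .inr ⟨h₁.1.trans h₂.1, fun A hA hAlt => h₂.2 A (h₁.2 A hA hAlt) hAlt⟩

theorem CanonicalRel.antisymm {M N : CanonicalWorld.{u}} (h₁ : CanonicalRel M N)
    (h₂ : CanonicalRel N M) : M = N := by
  rcases h₁ with h | h₁
  · exact h
  · rcases h₂ with h | h₂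
    · exact h.symm
    · exact absurd h₂.1 h₁.1.asymm

theorem canonical_altCut_mem (M : CanonicalWorld.{u}) (X : Graph) :
    .altCut X ∈ M.down.2.1 ↔ ∀ N, CanonicalRel M N → X ∉ N.down.2.1 := by
  rw [M.down.2.2.altCut_mem]
  -- A witness `Δ` is placed one level higher, so it is strictly accessible even when it equals the
  -- current set.
  exact ⟨fun h N hN => h _ N.down.2.2 hN.access,
    fun h Δ hΔ hR => h ⟨M.down.1 + 1, Δ, hΔ⟩ (.inr ⟨Nat.lt_succ_self _, hR⟩)⟩

open Classical in
/-- The canonical model with a given actual world. -/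
noncomputable def canonicalModel (M₀ : CanonicalWorld.{u}) : Model.{u} where
  World := CanonicalWorld.{u}
  actual := M₀
  R := CanonicalRel
  refl _ := .inl rfl
  trans _ _ _ := CanonicalRel.trans
  antisymm _ _ := CanonicalRel.antisymm
  -- With truth defined as membership, no inductive truth lemma is needed: the valuation rules are
  -- the closure properties of maximal consistent sets.
  V M X := decide (X.toGraph ∈ M.down.2.1)
  V_neg M X := by simp [Form.toGraph, M.down.2.2.cut_mem]
  V_and M X Y := by simp [Form.toGraph, M.down.2.2.juxt_mem]
  V_or M X Y := by
    simp [Form.toGraph, M.down.2.2.cut_mem, M.down.2.2.juxt_mem, or_iff_not_imp_left]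
  V_imp M X Y := by
    simp [Form.toGraph, M.down.2.2.cut_mem, M.down.2.2.juxt_mem, imp_iff_not_or]
  V_iff M X Y := by
    simp [Form.toGraph, M.down.2.2.cut_mem, M.down.2.2.juxt_mem, iff_def, imp_iff_not_or]
  V_altNeg M X := by simp [Form.toGraph, canonical_altCut_mem]
  V_altAtom M a :=
     ⟨fun h N hN => decide_eq_true (hN.access _ (of_decide_eq_true h) (.altAtom a)),
      fun h => h M (.inl rfl)⟩
  V_altImp M X Y := by
    simp [Form.toGraph, Form.plus, canonical_altCut_mem, MaxCons.cut_mem (Subtype.prop _),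
      MaxCons.juxt_mem (Subtype.prop _)]
  V_altOr M X Y := by
    simp [Form.toGraph, Form.plus, canonical_altCut_mem, MaxCons.cut_mem (Subtype.prop _),
      MaxCons.juxt_mem (Subtype.prop _)]
  V_altAnd M X Y := rfl
  V_altIff M X Y := by
    refine decide_eq_decide.2 ?_
    simp only [Form.toGraph, Form.plus, canonical_altCut_mem, MaxCons.cut_mem (Subtype.prop _),
      MaxCons.juxt_mem (Subtype.prop _), not_not, forall_and]

/-- A graph that is not valid is missing from some maximal consistent set. -/
theorem exists_maxCons_notMem {X : Graph} (h : ¬ Valid X) : ∃ Γ, MaxCons Γ ∧ X ∉ Γ := by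
  have hcons : ¬ Entails (insert (.cut X) ∅) bot := fun hb => by
    -- If `(X)` were inconsistent, `((X))` would follow from no premises, and the double cut could
    -- be removed.
    obtain ⟨l, hl, hd⟩ := hb.cut
    have hlam : Valid (conj l) := derives_conj fun Z hZ => (hl Z hZ).elim
    exact h ((hlam.trans hd).step (.doubleCut_inv .hole X))
  obtain ⟨Γ, hsub, hΓ⟩ := exists_maxCons hcons
  exact ⟨Γ, hΓ, hΓ.cut_mem.1 (hsub (Or.inl rfl))⟩

end Graph

end LD

theorem mainTheorem2 (X : LD.Form) : LD.Form.Valid.{u} X ↔ LD.Graph.Valid X.toGraph := by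
  constructor
  · intro h
    by_contra hX
    obtain ⟨Γ, hΓ, hmem⟩ := LD.Graph.exists_maxCons_notMem hX
    exact hmem (@of_decide_eq_true _ (_) (h (LD.Graph.canonicalModel ⟨0, Γ, hΓ⟩)))
  · intro h m
    exact (LD.Graph.holds_toGraph X m.actual).1 (h.holds m.actual trivial)
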